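/- **Setting.** Let $k\ge 1$. A $k$-distinguisher on $\mathbb N$ is an undirected $k$-hypergraph on the vertex set $\mathbb N$, i.e. a function $g:\mathbb N^k\to\{0,1\}$ invariant under permutations of its arguments, and a $k$-distinguishing class is a set $\mathcal G$ of $k$-distinguishers. For a probability distribution $p$ on $\mathbb N$ put $L_p(g)=\mathbb E_{v_{1:k}\sim p^k}[g(v_{1:k})]$, and for distributions $p_1,p_2$ put $$\mathrm{IPM}_{\mathcal G}(p_1,p_2)=\sup_{g\in\mathcal G}|L_{p_1}(g)-L_{p_2}(g)|.$$ A $\mathcal G$-discriminating algorithm with sample complexity $m(\epsilon,\delta)\in\mathbb N$ is a map $A$ that assigns to every pair of finite samples $(S_1,S_2)$ of vertices an element $g^A_S\in\mathcal G$ such that, for all $\epsilon>0$, $\delta\in(0,1)$ and all distributions $p_1,p_2$ on $\mathbb N$: if $S_1$ and $S_2$ are independent i.i.d. samples from $p_1$ and $p_2$ with $|S_1|,|S_2|>m(\epsilon,\delta)$, then with probability at least $1-\delta$ $$|L_{p_1}(g^A_S)-L_{p_2}(g^A_S)|>\mathrm{IPM}_{\mathcal G}(p_1,p_2)-\epsilon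 .$$ A class $\mathcal G$ has sample complexity at most $m(\epsilon,\delta)$ if such an algorithm exists, and it has bounded sample complexity (is discriminable) if this holds for some finite-valued function $m(\epsilon,\delta)$. **Theorem.** There is an absolute constant $C>0$ such that for every integer $k\ge 2$ there exists a $k$-distinguishing class $\mathcal G_k$ on $\mathbb N$ with the following two properties. 1. $\mathcal G_k$ has sample complexity at most some function $m(\epsilon,\delta)$ with $$m(\epsilon,\delta)\le C\,\frac{k^2+\log(1/\delta)}{\epsilon^2}\qquad\text{for all }\epsilon>0,\ \delta\in(0,1).$$ 2. For every $(k-1)$-distinguishing class $\mathcal G_{k-1}$ on $\mathbb N$ with bounded sample complexity, and every $\epsilon>0$, there are two probability distributions $p_1,p_2$ on $\mathbb N$ such that $$\mathrm{IPM}_{\mathcal G_{k-1}}(p_1,p_2)<\epsilon\qquad\text{and}\qquad \mathrm{IPM}_{\mathcal G_k}(p_1,p_2)>\tfrac14 .$$ -/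

import Mathlib

open MeasureTheory

noncomputable section

namespace GraphDiscriminator

/-- A `k`-distinguisher over the vertex set `V`: an undirected `k`-hypergraph, that is, a set of
hyperedges in `V ^ k` that is invariant under permutations of the coordinates.  Hyperedges with
repeated vertices are allowed.  A set `G : Set (Distinguisher k V)` is a `k`-distinguishing
class. -/
@[ext]
structure Distinguisher (k : ℕ) (V : Type*) where
  /-- The set of hyperedges. -/
  edges : Set (Fin k → V)
  /-- The hypergraph is undirected. -/
  symm : ∀ (π : Equiv.Perm (Fin k)) (v : Fin k → V), (v ∘ π) ∈ edges ↔ v ∈ edges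

variable {k : ℕ} {V : Type*} [MeasurableSpace V]

/-- The frequency `L_P(g) = P^k (E_g)` of an edge of `g` under the distribution `P`. -/
def freq (P : ProbabilityMeasure V) (g : Distinguisher k V) : ℝ :=
  (Measure.pi (fun _ : Fin k => (P : Measure V))).real g.edges

/-- The integral probability metric `sup_{g ∈ G} |L_{p₁}(g) - L_{p₂}(g)|`.  The quantities lie in
`[0, 1]`, so this is a genuine supremum as soon as `G` is nonempty. -/
def IPM (G : Set (Distinguisher k V)) (p₁ p₂ : ProbabilityMeasure V) : ℝ :=
  ⨆ g : G, |freq p₁ (g : Distinguisher k V) - freq p₂ (g : Distinguisher k V)|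

/-- An algorithm that receives two finite samples of vertices (of any sizes `m₁`, `m₂`) and
outputs a member of the class `G`. -/
abbrev Algorithm (G : Set (Distinguisher k V)) : Type _ :=
  (m₁ m₂ : ℕ) → (Fin m₁ → V) → (Fin m₂ → V) → G

/-- `A` is a `G`-discriminating algorithm with sample complexity `m`: whenever `S₁`, `S₂` are
independent i.i.d. samples from `p₁`, `p₂` of sizes larger than `m ε δ`, then with probability at
least `1 - δ` the output `g` satisfies `|L_{p₁}(g) - L_{p₂}(g)| > IPM_G(p₁, p₂) - ε`. -/
def IsDiscriminating (G : Set (Distinguisher k V)) (A : Algorithm G) (m : ℝ → ℝ → ℕ) : Prop :=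
  ∀ ε δ : ℝ, 0 < ε → 0 < δ → δ < 1 →
    ∀ m₁ m₂ : ℕ, m ε δ < m₁ → m ε δ < m₂ →
      ∀ p₁ p₂ : ProbabilityMeasure V,
        1 - δ ≤ ((Measure.pi (fun _ : Fin m₁ => (p₁ : Measure V))).prod
            (Measure.pi (fun _ : Fin m₂ => (p₂ : Measure V)))).real
          {S : (Fin m₁ → V) × (Fin m₂ → V) |
            IPM G p₁ p₂ - ε <
              |freq p₁ (A m₁ m₂ S.1 S.2 : Distinguisher k V) -
                freq p₂ (A m₁ m₂ S.1 S.2 : Distinguisher k V)|}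

/-- The class `G` is learnable by some discriminating algorithm with sample complexity `m`. -/
def HasSampleComplexity (G : Set (Distinguisher k V)) (m : ℝ → ℝ → ℕ) : Prop :=
  ∃ A : Algorithm G, IsDiscriminating G A m

/-- The class `G` is discriminable: its sample complexity is finite. -/
def Discriminable (G : Set (Distinguisher k V)) : Prop :=
  ∃ m : ℝ → ℝ → ℕ, HasSampleComplexity G m

end GraphDiscriminator

end

/-
Fix a finite field `F` with at least `10 (q + 1) ^ 2` units. The vertices are claims `(v, b)`,
asserting that the secret number `v` is `b`, and shares `(u, y)`, listing the values `y` of the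
secret polynomials at the unit `u`. Draw the polynomials `f v` of degree less than `q` at random.
Under `p₁` a random vertex is, with probability `1 / (q + 1)`, one of `n` claims `(v, f v (0))`, and
otherwise one of the shares of the polynomials; `p₂` has the false claims `(v, f v (0) + 1)`
instead. The edges of the share hypergraph consist of a claim and `q` distinct shares that
interpolate to it: under `p₁` their frequency is close to `(q / (q + 1)) ^ q ≥ exp (-1)`, under
`p₂` it vanishes.

A `q`-tuple that contains a claim contains fewer than `q` shares, so by Shamir's secret sharing it
carries no information about the secrets. To use this, keep only the shares over a set `S` of fewer
than `q` units; their values can be fixed while the secrets stay uniform. As each claim has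
probability at most `1 / n`, a fixed `q`-hypergraph distinguishes `p₁` from `p₂` only for few
secrets, by a second moment bound. The hypergraph chosen by a discriminating algorithm depends on
boundedly many secrets only, so for large `n` most secrets make the `IPM` small. A union bound over
`S` provides polynomials that are good for all `S`, and inclusion–exclusion over `S` passes from the
masked shares to all shares.
-/

open ProbabilityTheory

noncomputable section

namespace GraphDiscriminator

section Frequencies

variable {k : ℕ} {V : Type*} [MeasurableSpace V]

theorem abs_freq_sub_freq_le_one (p₁ p₂ : ProbabilityMeasure V) (g : Distinguisher k V) :
    |freq p₁ g - freq p₂ g| ≤ 1 :=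
  abs_sub_le_of_nonneg_of_le measureReal_nonneg measureReal_le_one measureReal_nonneg
    measureReal_le_one

theorem abs_freq_sub_freq_le_IPM (p₁ p₂ : ProbabilityMeasure V) {G : Set (Distinguisher k V)}
    {g : Distinguisher k V} (hg : g ∈ G) : |freq p₁ g - freq p₂ g| ≤ IPM G p₁ p₂ :=
  le_ciSup (f := fun g : G => |freq p₁ g.1 - freq p₂ g.1|)
    ⟨1, Set.forall_mem_range.2 fun g => abs_freq_sub_freq_le_one p₁ p₂ g.1⟩ ⟨g, hg⟩

theorem IPM_le {p₁ p₂ : ProbabilityMeasure V} {G : Set (Distinguisher k V)} {c : ℝ} (hc : 0 ≤ c)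
    (h : ∀ g ∈ G, |freq p₁ g - freq p₂ g| ≤ c) : IPM G p₁ p₂ ≤ c :=
  Real.iSup_le (fun g => h g.1 g.2) hc

theorem IPM_singleton (p₁ p₂ : ProbabilityMeasure V) (g : Distinguisher k V) :
    IPM {g} p₁ p₂ = |freq p₁ g - freq p₂ g| :=
  ciSup_unique

theorem hasSampleComplexity_singleton (g : Distinguisher k V) :
    HasSampleComplexity {g} fun _ _ => 0 := by
  refine ⟨fun _ _ _ _ => ⟨g, rfl⟩, fun ε δ hε hδ _ m₁ m₂ _ _ p₁ p₂ => ?_⟩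
  simp only [IPM_singleton, sub_lt_self_iff, hε, Set.ofPred_true, probReal_univ]
  linarith

end Frequencies

section Pushforward

theorem map_apply_of_countable {Ω V : Type*} [MeasurableSpace Ω] [MeasurableSpace V] [Countable Ω]
    [MeasurableSingletonClass V] {μ : Measure Ω} {f : Ω → V} (hf : Measurable f) (s : Set V) :
    μ.map f s = μ (f ⁻¹' s) := by
  have hnull : μ.map f (s \ Set.range f) = 0 := by
    refine measure_mono_null (Set.sdiff_subset_compl s _) ?_
    rw [Measure.map_apply hf (Set.countable_range f).measurableSet.compl, Set.preimage_compl,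
      Set.preimage_range, Set.compl_univ, measure_empty]
  have hs : NullMeasurableSet s (μ.map f) := by
    rw [← Set.inter_union_sdiff s (Set.range f)]
    have hcount : (s ∩ Set.range f).Countable :=
      (Set.countable_range f).mono Set.inter_subset_right
    exact hcount.measurableSet.nullMeasurableSet.union (NullMeasurableSet.of_null hnull)
  exact Measure.map_apply₀ hf.aemeasurable hs

variable {Ω V : Type*} [MeasurableSpace Ω] [DiscreteMeasurableSpace Ω] [MeasurableSpace V]

/-- The law of the random vertex `φ ω`, where the atom `ω` is drawn from `P`. -/
def law (P : ProbabilityMeasure Ω) (φ : Ω → V) : ProbabilityMeasure V :=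
  P.map (f := φ) Measurable.of_discrete.aemeasurable

theorem pi_law (P : ProbabilityMeasure Ω) (φ : Ω → V) (k : ℕ) :
    Measure.pi (fun _ : Fin k => (law P φ : Measure V)) =
      (Measure.pi fun _ : Fin k => (P : Measure Ω)).map (φ ∘ ·) :=
  (Measure.pi_map_pi fun _ => Measurable.of_discrete.aemeasurable).symm

variable [Countable Ω] [MeasurableSingletonClass V]

theorem freq_law {k : ℕ} (P : ProbabilityMeasure Ω) (φ : Ω → V) (g : Distinguisher k V) :
    freq (law P φ) g =
      (Measure.pi fun _ : Fin k => (P : Measure Ω)).real {t | φ ∘ t ∈ g.edges} := by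
  rw [freq, pi_law, Measure.real, map_apply_of_countable Measurable.of_discrete]
  rfl

theorem freq_law_eq_integral {k : ℕ} (P : ProbabilityMeasure Ω) (φ : Ω → V)
    (g : Distinguisher k V) : freq (law P φ) g =
      ∫ t, g.edges.indicator 1 (φ ∘ t) ∂Measure.pi fun _ : Fin k => (P : Measure Ω) := by
  rw [freq_law, ← integral_indicator_one .of_discrete]
  rfl

theorem measureReal_pi_law_prod_pi_law (P : ProbabilityMeasure Ω) (φ₁ φ₂ : Ω → V) (m₁ m₂ : ℕ)
    (s : Set ((Fin m₁ → V) × (Fin m₂ → V))) :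
    ((Measure.pi fun _ : Fin m₁ => (law P φ₁ : Measure V)).prod
      (Measure.pi fun _ : Fin m₂ => (law P φ₂ : Measure V))).real s =
    ((Measure.pi fun _ : Fin m₁ => (P : Measure Ω)).prod
      (Measure.pi fun _ : Fin m₂ => (P : Measure Ω))).real {t | (φ₁ ∘ t.1, φ₂ ∘ t.2) ∈ s} := by
  rw [pi_law, pi_law, Measure.map_prod_map _ _ Measurable.of_discrete Measurable.of_discrete,
    Measure.real, map_apply_of_countable Measurable.of_discrete]
  rfl

end Pushforward

section Counting

theorem sum_measureReal_le_of_ncard_le {α Ω : Type*} [Fintype α] [MeasurableSpace Ω]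
    {μ : Measure Ω} [IsProbabilityMeasure μ] {E : α → Set Ω} (hE : ∀ x, MeasurableSet (E x))
    {c : ℝ} (hc : ∀ s, ({x | s ∈ E x}.ncard : ℝ) ≤ c) : ∑ x, μ.real (E x) ≤ c := by
  classical
  have hint : ∀ x, Integrable ((E x).indicator (1 : Ω → ℝ)) μ := fun x =>
    (integrable_const 1).indicator (hE x)
  calc ∑ x, μ.real (E x) = ∫ s, ∑ x, (E x).indicator (1 : Ω → ℝ) s ∂μ := by
        rw [integral_finsetSum _ fun x _ => hint x]
        exact Finset.sum_congr rfl fun x _ => (integral_indicator_one (hE x)).symm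
    _ ≤ ∫ _, c ∂μ := by
        refine integral_mono (integrable_finsetSum _ fun x _ => hint x) (integrable_const c)
          fun s => ?_
        simpa [Set.indicator_apply, Finset.sum_boole, Set.ncard_eq_toFinset_card'] using hc s
    _ = c := by simp

theorem mul_ncard_le_of_le_measureReal {α Ω : Type*} [Finite α] [MeasurableSpace Ω]
    {μ : Measure Ω} [IsProbabilityMeasure μ] {E : α → Set Ω} (hE : ∀ x, MeasurableSet (E x))
    {p : α → Prop} {δ c : ℝ} (hδ : ∀ x, p x → δ ≤ μ.real (E x))
    (hc : ∀ s, ({x | s ∈ E x}.ncard : ℝ) ≤ c) : δ * {x | p x}.ncard ≤ c := by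
  classical
  have := Fintype.ofFinite α
  calc δ * {x | p x}.ncard ≤ ∑ x ∈ {x | p x}.toFinset, μ.real (E x) := by
        rw [Set.ncard_eq_toFinset_card', mul_comm, ← nsmul_eq_mul]
        exact Finset.card_nsmul_le_sum _ _ _ fun x hx => hδ x (Set.mem_toFinset.1 hx)
    _ ≤ ∑ x, μ.real (E x) := Finset.sum_le_univ_sum_of_nonneg fun _ => measureReal_nonneg
    _ ≤ c := sum_measureReal_le_of_ncard_le hE hc

theorem sq_mul_ncard_lt_abs_le_sum_sq {α : Type*} [Fintype α] (f : α → ℝ) {t : ℝ} (ht : 0 ≤ t) :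
    t ^ 2 * {x | t < |f x|}.ncard ≤ ∑ x, f x ^ 2 := by
  classical
  rw [Set.ncard_eq_toFinset_card', mul_comm, ← nsmul_eq_mul]
  calc {x | t < |f x|}.toFinset.card • t ^ 2 ≤ ∑ x ∈ {x | t < |f x|}.toFinset, f x ^ 2 :=
        Finset.card_nsmul_le_sum _ _ _ fun x hx =>
          sq_le_sq.2 <| (abs_of_nonneg ht).trans_le (by simpa using hx : t < |f x|).le
    _ ≤ ∑ x, f x ^ 2 :=
        Finset.sum_le_univ_sum_of_nonneg fun x => sq_nonneg _

theorem ncard_setOf_comp_le {α β γ : Type*} [Finite α] [Finite γ] {f : α → β} {d : γ → β}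
    (hf : ∀ x, ∃ y, f x = d y) (p : α → β → Prop) {c : ℝ}
    (hc : ∀ b, ({x | p x b}.ncard : ℝ) ≤ c) : ({x | p x (f x)}.ncard : ℝ) ≤ Nat.card γ * c := by
  have := Fintype.ofFinite γ
  have hsub : {x | p x (f x)} ⊆ ⋃ y, {x | p x (d y)} := fun x hx =>
    let ⟨y, hy⟩ := hf x
    Set.mem_iUnion.2 ⟨y, by simpa only [Set.mem_ofPred_eq, hy] using hx⟩
  calc ({x | p x (f x)}.ncard : ℝ) ≤ ∑ y, ({x | p x (d y)}.ncard : ℝ) := by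
        exact_mod_cast (Set.ncard_le_ncard hsub).trans (Set.ncard_iUnion_le_of_fintype _)
    _ ≤ ∑ _ : γ, c := Finset.sum_le_sum fun y _ => hc _
    _ = Nat.card γ * c := by simp

theorem ncard_le_of_translates {A B : Type*} [AddGroup A] [Finite A] [Finite B] [Nonempty B]
    (s : B → A) (T : Set A) {c : ℝ} (h : ∀ a, ({b | a + s b ∈ T}.ncard : ℝ) ≤ c * Nat.card B) :
    (T.ncard : ℝ) ≤ c * Nat.card A := by
  classical
  have := Fintype.ofFinite A
  have := Fintype.ofFinite B
  have htranslate : ∀ b, {a | a + s b ∈ T}.ncard = T.ncard := fun b =>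
    Set.ncard_preimage_of_injective_subset_range (add_left_injective (s b)) <| by
      simp [(add_right_surjective (s b)).range_eq]
  have hcount : ∑ a, ({b | a + s b ∈ T}.ncard : ℝ) = ∑ b, ({a | a + s b ∈ T}.ncard : ℝ) := by
    simp only [Set.ncard_eq_toFinset_card', Set.toFinset_ofPred, Finset.card_filter, Nat.cast_sum]
    exact Finset.sum_comm
  simp only [htranslate, Finset.sum_const, Finset.card_univ, nsmul_eq_mul,
    ← Nat.card_eq_fintype_card] at hcount
  have hB : (0 : ℝ) < Nat.card B := by exact_mod_cast Nat.card_pos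
  refine le_of_mul_le_mul_left ?_ hB
  calc Nat.card B * (T.ncard : ℝ) ≤ ∑ _ : A, c * Nat.card B :=
        hcount ▸ Finset.sum_le_sum fun a _ => h a
    _ = Nat.card B * (c * Nat.card A) := by
        rw [Finset.sum_const, Finset.card_univ, nsmul_eq_mul, Nat.card_eq_fintype_card (α := A)]
        ring

theorem exists_forall_notMem_of_ncard_le {α γ : Type*} [Finite α] [Nonempty α] [Finite γ]
    {T : γ → Set α} {c : ℝ} (hc : Nat.card γ * c < 1)
    (h : ∀ y, ((T y).ncard : ℝ) ≤ c * Nat.card α) : ∃ x, ∀ y, x ∉ T y := by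
  have := Fintype.ofFinite γ
  by_contra! hx
  have hα : (0 : ℝ) < Nat.card α := by exact_mod_cast Nat.card_pos
  have : (Nat.card α : ℝ) ≤ Nat.card γ * c * Nat.card α :=
    calc (Nat.card α : ℝ) = (⋃ y, T y).ncard := by
          rw [Set.iUnion_eq_univ_iff.2 hx, Set.ncard_univ]
      _ ≤ ∑ y, ((T y).ncard : ℝ) := by exact_mod_cast Set.ncard_iUnion_le_of_fintype T
      _ ≤ ∑ _ : γ, c * Nat.card α := Finset.sum_le_sum fun y _ => h y
      _ = Nat.card γ * c * Nat.card α := by simp [mul_assoc]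
  nlinarith

end Counting

section Collisions

variable {S Ω : Type*} [MeasurableSpace S] [MeasurableSpace Ω] [Finite Ω]
  [DiscreteMeasurableSpace Ω]

theorem measureReal_eq_and_mem_le {μ : Measure S} [IsProbabilityMeasure μ] {a b : S → Ω}
    (ha : Measurable a) (hab : IndepFun a b μ) (A : Set Ω) {β : ℝ}
    (hβ₀ : 0 ≤ β) (hβ : ∀ ω ∈ A, μ.real (b ⁻¹' {ω}) ≤ β) :
    μ.real {s | a s = b s ∧ a s ∈ A} ≤ β := by
  classical
  have := Fintype.ofFinite Ω
  have hset : {s | a s = b s ∧ a s ∈ A} = ⋃ ω ∈ A.toFinset, a ⁻¹' {ω} ∩ b ⁻¹' {ω} := by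
    ext s; simp [eq_comm, and_comm]
  have hterm : ∀ ω ∈ A.toFinset, μ.real (a ⁻¹' {ω} ∩ b ⁻¹' {ω}) ≤ μ.real (a ⁻¹' {ω}) * β := by
    intro ω hω
    rw [Measure.real, hab.measure_inter_preimage_eq_mul _ _ .of_discrete .of_discrete,
      ENNReal.toReal_mul]
    refine mul_le_mul_of_nonneg_left ?_ measureReal_nonneg
    exact hβ ω (Set.mem_toFinset.1 hω)
  calc μ.real {s | a s = b s ∧ a s ∈ A}
      ≤ ∑ ω ∈ A.toFinset, μ.real (a ⁻¹' {ω} ∩ b ⁻¹' {ω}) :=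
        hset ▸ measureReal_biUnion_finset_le _ _
    _ ≤ ∑ ω ∈ A.toFinset, μ.real (a ⁻¹' {ω}) * β := Finset.sum_le_sum hterm
    _ ≤ ∑ ω, μ.real (a ⁻¹' {ω}) * β :=
        Finset.sum_le_univ_sum_of_nonneg fun ω => by positivity
    _ = β := by
        rw [← Finset.sum_mul, sum_measureReal_preimage_singleton _ fun _ _ => ha .of_discrete]
        simp

theorem measureReal_iUnion_le_card_mul {ι : Type*} [Fintype ι] {μ : Measure S}
    {E : ι → Set S} {β : ℝ} (h : ∀ i, μ.real (E i) ≤ β) :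
    μ.real (⋃ i, E i) ≤ Fintype.card ι * β :=
  (measureReal_iUnion_fintype_le E).trans <| (Finset.sum_le_sum fun i _ => h i).trans (by simp)

variable (P : ProbabilityMeasure Ω) {A : Set Ω} {β : ℝ}

theorem measureReal_pi_exists_eq_mem_le (k : ℕ) (hβ₀ : 0 ≤ β)
    (hβ : ∀ ω ∈ A, (P : Measure Ω).real {ω} ≤ β) :
    (Measure.pi fun _ : Fin k => (P : Measure Ω)).real {t | ∃ i j, i ≠ j ∧ t i = t j ∧ t i ∈ A} ≤
      k ^ 2 * β := by
  set μ := Measure.pi fun _ : Fin k => (P : Measure Ω)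
  have hpair : ∀ p : Fin k × Fin k, μ.real {t | p.1 ≠ p.2 ∧ t p.1 = t p.2 ∧ t p.1 ∈ A} ≤ β := by
    rintro ⟨i, j⟩
    by_cases hij : i = j
    · simpa [hij] using hβ₀
    simp only [ne_eq, hij, not_false_eq_true, true_and]
    have hindep : IndepFun (fun t : Fin k → Ω => t i) (fun t => t j) μ :=
      (iIndepFun_pi (μ := fun _ => (P : Measure Ω)) (X := fun _ => id)
        fun _ => aemeasurable_id).indepFun hij
    exact measureReal_eq_and_mem_le (measurable_pi_apply i) hindep A hβ₀
      fun ω hω => ((measurePreserving_eval _ j).measureReal_preimage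
        MeasurableSet.of_discrete.nullMeasurableSet).trans_le (hβ ω hω)
  convert measureReal_iUnion_le_card_mul hpair using 2
  · ext; simp
  · simp [sq]

theorem measureReal_prod_exists_eq_mem_le (k : ℕ) (hβ₀ : 0 ≤ β)
    (hβ : ∀ ω ∈ A, (P : Measure Ω).real {ω} ≤ β) :
    ((Measure.pi fun _ : Fin k => (P : Measure Ω)).prod
      (Measure.pi fun _ : Fin k => (P : Measure Ω))).real {t | ∃ i j, t.1 i = t.2 j ∧ t.1 i ∈ A} ≤
      k ^ 2 * β := by
  set μ := Measure.pi fun _ : Fin k => (P : Measure Ω)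
  have hpair : ∀ p : Fin k × Fin k, (μ.prod μ).real {t | t.1 p.1 = t.2 p.2 ∧ t.1 p.1 ∈ A} ≤ β := by
    rintro ⟨i, j⟩
    have hindep : IndepFun (fun t : (Fin k → Ω) × (Fin k → Ω) => t.1 i) (fun t => t.2 j)
        (μ.prod μ) :=
      indepFun_prod (X := fun t : Fin k → Ω => t i) (Y := fun t : Fin k → Ω => t j)
        (measurable_pi_apply i) (measurable_pi_apply j)
    refine measureReal_eq_and_mem_le ((measurable_pi_apply i).comp measurable_fst) hindep A hβ₀
      fun ω hω => ?_
    calc (μ.prod μ).real ((fun t => t.2 j) ⁻¹' {ω})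
        = μ.real (Function.eval j ⁻¹' {ω}) :=
          measurePreserving_snd.measureReal_preimage
            (measurable_pi_apply j .of_discrete).nullMeasurableSet
      _ = (P : Measure Ω).real {ω} :=
          (measurePreserving_eval _ j).measureReal_preimage
            MeasurableSet.of_discrete.nullMeasurableSet
      _ ≤ β := hβ ω hω
  convert measureReal_iUnion_le_card_mul hpair using 2
  · ext; simp
  · simp [sq]

end Collisions

section Decorrelation

variable {ι F : Type*} [Fintype ι] [DecidableEq ι] [Fintype F]

theorem sum_mul_eq_zero_of_dependsOn {R : Type*} [CommRing R] [NoZeroDivisors R] [CharZero R]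
    {f g : (ι → F) → R} {s t : Set ι} (hf : DependsOn f s) (hg : DependsOn g t)
    (hst : Disjoint s t) (hf₀ : ∑ X, f X = 0) : ∑ X, f X * g X = 0 := by
  classical
  cases isEmpty_or_nonempty (ι → F)
  · exact Fintype.sum_empty _
  have hswap : Function.Involutive fun p : (ι → F) × (ι → F) =>
      (s.piecewise p.1 p.2, s.piecewise p.2 p.1) := fun p => by
    ext i <;> by_cases hi : i ∈ s <;> simp [hi]
  have hprod :
      ∑ p : (ι → F) × (ι → F), f p.1 * g p.1 = ∑ p : (ι → F) × (ι → F), f p.1 * g p.2 := by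
    refine (Equiv.sum_comp hswap.toPerm fun p => f p.1 * g p.1).symm.trans <|
      Finset.sum_congr rfl fun p _ => congrArg₂ _ (hf fun i hi => ?_) (hg fun i hi => ?_)
    · exact s.piecewise_eq_of_mem _ _ hi
    · exact s.piecewise_eq_of_notMem _ _ (hst.notMem_of_mem_right hi)
  rw [Fintype.sum_prod_type, Fintype.sum_prod_type, ← Finset.sum_mul_sum, hf₀, zero_mul] at hprod
  simp only [Finset.sum_const, Finset.card_univ, ← Finset.smul_sum] at hprod
  exact (smul_eq_zero.1 hprod).resolve_left Fintype.card_ne_zero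

theorem sum_sq_integral_le {T : Type*} [MeasurableSpace T] [Countable T] [DiscreteMeasurableSpace T]
    {μ : Measure T} [IsProbabilityMeasure μ] {D : T → (ι → F) → ℝ} {supp : T → Set ι}
    (hD : ∀ t X, |D t X| ≤ 1) (hsum : ∀ t, ∑ X, D t X = 0)
    (hsupp : ∀ t, DependsOn (D t) (supp t)) :
    ∑ X, (∫ t, D t X ∂μ) ^ 2 ≤
      (μ.prod μ).real {p | ¬Disjoint (supp p.1) (supp p.2)} * Fintype.card (ι → F) := by
  set B : Set (T × T) := {p | ¬Disjoint (supp p.1) (supp p.2)}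
  have hint : ∀ X, Integrable (fun p : T × T => D p.1 X * D p.2 X) (μ.prod μ) := fun X =>
    Integrable.of_bound Measurable.of_discrete.aestronglyMeasurable 1 <| .of_forall fun p => by
      simpa [abs_mul] using mul_le_one₀ (hD p.1 X) (abs_nonneg _) (hD p.2 X)
  have hcov : ∀ p : T × T, ∑ X, D p.1 X * D p.2 X ≤
      B.indicator (fun _ => (Fintype.card (ι → F) : ℝ)) p := by
    intro p
    by_cases hp : p ∈ B
    · rw [Set.indicator_of_mem hp]
      calc ∑ X, D p.1 X * D p.2 X ≤ ∑ _ : ι → F, (1 : ℝ) := by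
            refine Finset.sum_le_sum fun X _ => (le_abs_self _).trans ?_
            simpa [abs_mul] using mul_le_one₀ (hD p.1 X) (abs_nonneg _) (hD p.2 X)
        _ = Fintype.card (ι → F) := by simp
    · rw [Set.indicator_of_notMem hp]
      exact (sum_mul_eq_zero_of_dependsOn (hsupp p.1) (hsupp p.2) (not_not.1 hp) (hsum p.1)).le
  calc ∑ X, (∫ t, D t X ∂μ) ^ 2 = ∫ p, ∑ X, D p.1 X * D p.2 X ∂μ.prod μ := by
        rw [integral_finsetSum _ fun X _ => hint X]
        exact Finset.sum_congr rfl fun X _ => by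
          rw [sq, integral_prod_mul (fun t => D t X) fun t => D t X]
    _ ≤ ∫ p, B.indicator (fun _ => (Fintype.card (ι → F) : ℝ)) p ∂μ.prod μ :=
        integral_mono (integrable_finsetSum _ fun X _ => hint X)
          ((integrable_const _).indicator .of_discrete) hcov
    _ = (μ.prod μ).real B * Fintype.card (ι → F) := by
        rw [integral_indicator_const _ .of_discrete, smul_eq_mul]

end Decorrelation

section Placement

/-- The placement of atoms in which the atom `inr i` sits at the vertex carrying label `X i` among
the vertices `l i` reserved for it, while the atoms in `R` sit at fixed vertices. -/
def placement {R ι F V : Type*} (y : R → V) (l : ι → F → V) (X : ι → F) : R ⊕ ι → V :=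
  Sum.elim y fun i => l i (X i)

variable {R ι F V : Type*} {y : R → V} {l : ι → F → V}

theorem placement_comp_congr {k : ℕ} {t : Fin k → R ⊕ ι} {X X' : ι → F}
    (h : ∀ i ∈ {i | Sum.inr i ∈ Set.range t}, X i = X' i) :
    placement y l X ∘ t = placement y l X' ∘ t := by
  ext j
  rcases hj : t j with u | i
  · simp [placement, hj]
  · simp [placement, hj, h i ⟨j, hj⟩]

theorem exists_placement_comp_eq [Nonempty F] {k : ℕ} (t : Fin k → R ⊕ ι) (X : ι → F) :
    ∃ Y : Fin k → F, placement y l X ∘ t = fun j => placement y l (fun _ => Y j) (t j) := by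
  refine ⟨fun j => Sum.elim (fun _ => Classical.arbitrary F) X (t j), ?_⟩
  ext j
  rcases hj : t j with u | i <;> simp [placement, hj]

variable [Finite R] [Fintype ι] [DecidableEq ι] [Fintype F] [MeasurableSpace (R ⊕ ι)]
  [DiscreteMeasurableSpace (R ⊕ ι)] [MeasurableSpace V] [MeasurableSingletonClass V]
  {P : ProbabilityMeasure (R ⊕ ι)} {β : ℝ}

theorem sum_sq_freq_placement_le (hβ₀ : 0 ≤ β)
    (hβ : ∀ i, (P : Measure (R ⊕ ι)).real {Sum.inr i} ≤ β)
    (τ : Equiv.Perm F) {q : ℕ} (h : Distinguisher q V) :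
    ∑ X : ι → F, (freq (law P (placement y l X)) h - freq (law P (placement y l (τ ∘ X))) h) ^ 2 ≤
      q ^ 2 * β * Fintype.card (ι → F) := by
  set μ := Measure.pi fun _ : Fin q => (P : Measure (R ⊕ ι))
  let c (t : Fin q → R ⊕ ι) (X : ι → F) : ℝ := h.edges.indicator 1 (placement y l X ∘ t)
  let supp (t : Fin q → R ⊕ ι) : Set ι := {i | Sum.inr i ∈ Set.range t}
  have hfreq : ∀ X, freq (law P (placement y l X)) h = ∫ t, c t X ∂μ := fun X =>
    freq_law_eq_integral P _ h
  have hc : ∀ t, DependsOn (c t) (supp t) := fun t X X' hX =>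
    congrArg (h.edges.indicator 1) (placement_comp_congr hX)
  have hsum : ∀ t, ∑ X, (c t X - c t (τ ∘ X)) = 0 := fun t => by
    rw [Finset.sum_sub_distrib, sub_eq_zero]
    exact ((Equiv.piCongrRight fun _ : ι => τ).sum_comp (c t)).symm
  have hc_mem : ∀ t X, 0 ≤ c t X ∧ c t X ≤ 1 := fun t X =>
    ⟨Set.indicator_nonneg (fun _ _ => zero_le_one) _,
      Set.indicator_le_self' (fun _ _ => zero_le_one) _⟩
  have hmoment := sum_sq_integral_le (μ := μ) (D := fun t X => c t X - c t (τ ∘ X)) (supp := supp)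
    (fun t X => abs_sub_le_of_nonneg_of_le (hc_mem t X).1 (hc_mem t X).2 (hc_mem t _).1
      (hc_mem t _).2)
    hsum fun t X X' hX => congrArg₂ _ (hc t hX) (hc t fun i hi => congrArg τ (hX i hi))
  have hcollision : {p | ¬Disjoint (supp p.1) (supp p.2)} ⊆
      {p : (Fin q → R ⊕ ι) × (Fin q → R ⊕ ι) |
        ∃ i j, p.1 i = p.2 j ∧ p.1 i ∈ Set.range Sum.inr} := by
    intro p hp
    obtain ⟨v, ⟨i, hi⟩, j, hj⟩ := Set.not_disjoint_iff.1 hp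
    exact ⟨i, j, hi.trans hj.symm, v, hi.symm⟩
  calc _ = ∑ X : ι → F, (∫ t, (c t X - c t (τ ∘ X)) ∂μ) ^ 2 := by
        simp only [hfreq, integral_sub Integrable.of_finite Integrable.of_finite]
    _ ≤ _ := hmoment
    _ ≤ q ^ 2 * β * Fintype.card (ι → F) := by
        gcongr
        exact (measureReal_mono hcollision).trans <|
          measureReal_prod_exists_eq_mem_le P q hβ₀ (Set.forall_mem_range.2 hβ)

end Placement

theorem IsDiscriminating.half_le_measureReal {k : ℕ} {V : Type*} [MeasurableSpace V]
    {H : Set (Distinguisher k V)} {A : Algorithm H} {m : ℝ → ℝ → ℕ} (hA : IsDiscriminating H A m)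
    {ε : ℝ} (hε : 0 < ε) {p₁ p₂ : ProbabilityMeasure V} (h : ε ≤ IPM H p₁ p₂) :
    1 / 2 ≤ ((Measure.pi fun _ : Fin (m (ε / 2) (1 / 2) + 1) => (p₁ : Measure V)).prod
      (Measure.pi fun _ : Fin (m (ε / 2) (1 / 2) + 1) => (p₂ : Measure V))).real
      {S | ε / 2 < |freq p₁ (A _ _ S.1 S.2).1 - freq p₂ (A _ _ S.1 S.2).1|} := by
  have hsuccess := hA (ε / 2) (1 / 2) (by positivity) (by norm_num) (by norm_num) _ _
    (Nat.lt_succ_self _) (Nat.lt_succ_self _) p₁ p₂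
  have hhalf : ε / 2 ≤ IPM H p₁ p₂ - ε / 2 := by linarith
  exact le_trans (by norm_num) (hsuccess.trans (measureReal_mono fun _ => hhalf.trans_lt))

theorem IsDiscriminating.ncard_le_IPM_placement_le {R ι F V : Type*} [Finite R] [Finite ι]
    [Finite F] [Nonempty F] [MeasurableSpace (R ⊕ ι)] [DiscreteMeasurableSpace (R ⊕ ι)]
    [MeasurableSpace V] [MeasurableSingletonClass V] {P : ProbabilityMeasure (R ⊕ ι)} {q : ℕ}
    {H : Set (Distinguisher q V)} {A : Algorithm H} {m : ℝ → ℝ → ℕ} (hA : IsDiscriminating H A m)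
    {ε β : ℝ} (hε : 0 < ε) (hβ₀ : 0 ≤ β) (hβ : ∀ i, (P : Measure (R ⊕ ι)).real {Sum.inr i} ≤ β)
    (τ : Equiv.Perm F) (y : R → V) (l : ι → F → V) :
    ({X | ε ≤ IPM H (law P (placement y l X)) (law P (placement y l (τ ∘ X)))}.ncard : ℝ) ≤
      8 * (Nat.card F : ℝ) ^ (2 * (m (ε / 2) (1 / 2) + 1)) * q ^ 2 * β / ε ^ 2 *
        Nat.card (ι → F) := by
  classical
  have := Fintype.ofFinite ι
  have := Fintype.ofFinite F
  set M := m (ε / 2) (1 / 2) + 1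
  let p (X : ι → F) : ProbabilityMeasure V := law P (placement y l X)
  let gap (X : ι → F) (S : (Fin M → V) × (Fin M → V)) : ℝ :=
    freq (p X) (A _ _ S.1 S.2).1 - freq (p (τ ∘ X)) (A _ _ S.1 S.2).1
  let sample (X : ι → F) (t : (Fin M → R ⊕ ι) × (Fin M → R ⊕ ι)) : (Fin M → V) × (Fin M → V) :=
    (placement y l X ∘ t.1, placement y l (τ ∘ X) ∘ t.2)
  set μ := (Measure.pi fun _ : Fin M => (P : Measure (R ⊕ ι))).prod
    (Measure.pi fun _ : Fin M => (P : Measure (R ⊕ ι)))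
  have hsuccess : ∀ X, ε ≤ IPM H (p X) (p (τ ∘ X)) →
      1 / 2 ≤ μ.real {t | ε / 2 < |gap X (sample X t)|} := fun X hX =>
    (hA.half_le_measureReal hε hX).trans_eq (measureReal_pi_law_prod_pi_law P _ _ M M _)
  have hfixed : ∀ S, ({X | ε / 2 < |gap X S|}.ncard : ℝ) ≤
      q ^ 2 * β * Nat.card (ι → F) / (ε / 2) ^ 2 := fun S => by
    rw [le_div_iff₀' (by positivity), Nat.card_eq_fintype_card]
    exact (sq_mul_ncard_lt_abs_le_sum_sq _ (by positivity)).trans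
      (sum_sq_freq_placement_le hβ₀ hβ τ _)
  have hsample : ∀ t, ({X | ε / 2 < |gap X (sample X t)|}.ncard : ℝ) ≤
      Nat.card ((Fin M → F) × (Fin M → F)) * (q ^ 2 * β * Nat.card (ι → F) / (ε / 2) ^ 2) := by
    refine fun t => ncard_setOf_comp_le (d := fun Y : (Fin M → F) × (Fin M → F) =>
      (fun j => placement y l (fun _ => Y.1 j) (t.1 j),
        fun j => placement y l (fun _ => Y.2 j) (t.2 j))) (fun X => ?_)
      (fun X S => ε / 2 < |gap X S|) hfixed
    obtain ⟨Y₁, h₁⟩ := exists_placement_comp_eq (y := y) (l := l) t.1 X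
    obtain ⟨Y₂, h₂⟩ := exists_placement_comp_eq (y := y) (l := l) t.2 (τ ∘ X)
    exact ⟨(Y₁, Y₂), Prod.ext h₁ h₂⟩
  have hhalf := mul_ncard_le_of_le_measureReal (fun _ => .of_discrete) hsuccess hsample
  refine ((le_div_iff₀' (by norm_num)).2 hhalf).trans_eq ?_
  rw [Nat.card_prod, Nat.card_fun, Nat.card_fin]
  push_cast
  field_simp
  ring

section InclusionExclusion

variable {R 𝕜 : Type*} [DecidableEq R] [CommRing 𝕜]

/-- The Möbius transform of a set function `G`: the coefficients of the inclusion–exclusion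
expansion `G J = ∑ I ∈ J.powerset, moebius G I`. -/
def moebius (G : Finset R → 𝕜) (I : Finset R) : 𝕜 :=
  ∑ S ∈ I.powerset, (-1) ^ (I \ S).card * G S

theorem moebius_insert (G : Finset R → 𝕜) {u : R} {I : Finset R} (hu : u ∉ I) :
    moebius G (insert u I) = moebius (fun S => G (insert u S)) I - moebius G I := by
  simp only [moebius, Finset.sum_powerset_insert hu, sub_eq_neg_add, ← Finset.sum_neg_distrib]
  congr 1 <;> refine Finset.sum_congr rfl fun S hS => ?_
  · have huS : u ∉ S := fun h => hu (Finset.mem_powerset.1 hS h)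
    rw [Finset.insert_sdiff_of_notMem _ huS, Finset.card_insert_of_notMem (by simp [hu]), pow_succ]
    ring
  · rw [Finset.insert_sdiff_insert, Finset.sdiff_insert_of_notMem hu]

theorem sum_powerset_moebius (G : Finset R → 𝕜) (J : Finset R) :
    ∑ I ∈ J.powerset, moebius G I = G J := by
  induction J using Finset.induction_on generalizing G with
  | empty => simp [moebius]
  | insert u J hu ih =>
    have hinsert : ∀ I ∈ J.powerset,
        moebius G (insert u I) = moebius (fun S => G (insert u S)) I - moebius G I := fun I hI =>
      moebius_insert G fun h => hu (Finset.mem_powerset.1 hI h)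
    rw [Finset.sum_powerset_insert hu, Finset.sum_congr rfl hinsert, Finset.sum_sub_distrib,
      add_sub_cancel, ih]

theorem moebius_eq_zero {G : Finset R → 𝕜} {u : R} {I : Finset R} (hu : u ∈ I)
    (hG : ∀ S, G (insert u S) = G S) : moebius G I = 0 := by
  rw [← Finset.insert_erase hu, moebius_insert G (Finset.notMem_erase u I), funext hG, sub_self]

theorem sum_card_lt_moebius [Fintype R] {G : Finset R → 𝕜} {J : Finset R} {q : ℕ} (hJ : J.card < q)
    (hG : ∀ S, G S = G (S ∩ J)) : ∑ I with I.card < q, moebius G I = G Finset.univ := by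
  have hsub : J.powerset ⊆ ({I | I.card < q} : Finset (Finset R)) := fun I hI => by
    simpa using (Finset.card_le_card (Finset.mem_powerset.1 hI)).trans_lt hJ
  rw [hG Finset.univ, Finset.univ_inter, ← sum_powerset_moebius G J]
  refine (Finset.sum_subset hsub fun I _ hI => ?_).symm
  obtain ⟨u, huI, huJ⟩ := Finset.not_subset.1 (Finset.mem_powerset.not.1 hI)
  refine moebius_eq_zero huI fun S => ?_
  rw [hG, Finset.insert_inter_of_notMem huJ, ← hG]

theorem abs_moebius_le {G : Finset R → ℝ} {I : Finset R} {η : ℝ} (hG : ∀ S ⊆ I, |G S| ≤ η) :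
    |moebius G I| ≤ 2 ^ I.card * η := by
  calc |moebius G I| ≤ ∑ S ∈ I.powerset, |(-1) ^ (I \ S).card * G S| :=
        Finset.abs_sum_le_sum_abs _ _
    _ ≤ ∑ _ ∈ I.powerset, η := Finset.sum_le_sum fun S hS => by
        simpa [abs_mul] using hG S (Finset.mem_powerset.1 hS)
    _ = 2 ^ I.card * η := by simp

end InclusionExclusion

section Masking

variable {R ι V : Type*}

theorem exists_card_lt_of_apply_eq_inr {q : ℕ} {t : Fin q → R ⊕ ι} {i : Fin q} {v : ι}
    (hi : t i = Sum.inr v) : ∃ J : Finset R, J.card < q ∧ ∀ j u, t j = Sum.inl u → u ∈ J := by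
  classical
  refine ⟨((Finset.univ.erase i).image t).toLeft, ?_, fun j u hj => ?_⟩
  · calc ((Finset.univ.erase i).image t).toLeft.card ≤ (Finset.univ.erase i).card :=
          Finset.card_toLeft_le.trans Finset.card_image_le
      _ < q := by simpa using Finset.card_erase_lt_of_mem (Finset.mem_univ i)
  · refine Finset.mem_toLeft.2 (Finset.mem_image.2 ⟨j, ?_, hj⟩)
    simp only [Finset.mem_erase, Finset.mem_univ, and_true]
    rintro rfl
    exact Sum.inl_ne_inr (hj.symm.trans hi)

variable [Fintype R] [DecidableEq R]

theorem sum_card_lt_moebius_piecewise {𝕜 : Type*} [CommRing 𝕜] {q : ℕ} (c : (Fin q → V) → 𝕜)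
    (y y₀ : R → V) (z z' : ι → V) (t : Fin q → R ⊕ ι) :
    ∑ I : Finset R with I.card < q, moebius (fun S =>
      c (Sum.elim (S.piecewise y y₀) z ∘ t) - c (Sum.elim (S.piecewise y y₀) z' ∘ t)) I =
    c (Sum.elim y z ∘ t) - c (Sum.elim y z' ∘ t) := by
  by_cases hclaim : ∃ i v, t i = Sum.inr v
  · obtain ⟨i, v, hi⟩ := hclaim
    obtain ⟨J, hJ, htJ⟩ := exists_card_lt_of_apply_eq_inr hi
    have hpiecewise : ∀ (S : Finset R) (w : ι → V), Sum.elim (S.piecewise y y₀) w ∘ t =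
        Sum.elim ((S ∩ J).piecewise y y₀) w ∘ t := fun S w => funext fun j => by
      rcases hj : t j with u | v
      · simp [hj, Finset.piecewise, htJ j u hj]
      · simp [hj]
    rw [sum_card_lt_moebius hJ fun S => by rw [hpiecewise S z, hpiecewise S z']]
    simp
  · have hconst : ∀ x : R → V, Sum.elim x z ∘ t = Sum.elim x z' ∘ t := fun x => funext fun j => by
      rcases hj : t j with u | v
      · simp [hj]
      · exact (hclaim ⟨j, v, hj⟩).elim
    simp [hconst, moebius]

variable [Finite ι] [MeasurableSpace (R ⊕ ι)] [DiscreteMeasurableSpace (R ⊕ ι)]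
  [MeasurableSpace V] [MeasurableSingletonClass V]

theorem sum_card_lt_moebius_freq (P : ProbabilityMeasure (R ⊕ ι)) (y y₀ : R → V) (z z' : ι → V)
    {q : ℕ} (g : Distinguisher q V) :
    ∑ I : Finset R with I.card < q, moebius (fun S =>
      freq (law P (Sum.elim (S.piecewise y y₀) z)) g -
        freq (law P (Sum.elim (S.piecewise y y₀) z')) g) I =
    freq (law P (Sum.elim y z)) g - freq (law P (Sum.elim y z')) g := by
  let c : (Fin q → V) → ℝ := g.edges.indicator 1
  have hint : ∀ φ : R ⊕ ι → V,
      Integrable (fun t => c (φ ∘ t)) (Measure.pi fun _ : Fin q => (P : Measure (R ⊕ ι))) :=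
    fun _ => .of_finite
  have hfreq : ∀ φ : R ⊕ ι → V, freq (law P φ) g =
      ∫ t, c (φ ∘ t) ∂Measure.pi fun _ : Fin q => (P : Measure (R ⊕ ι)) := fun φ =>
    freq_law_eq_integral P φ g
  simp only [hfreq, ← integral_sub (hint _) (hint _), moebius, ← integral_const_mul]
  rw [← integral_congr_ae (.of_forall fun t => sum_card_lt_moebius_piecewise c y y₀ z z' t)]
  simp only [moebius]
  rw [integral_finsetSum _ fun _ _ => .of_finite]
  exact Finset.sum_congr rfl fun I _ => (integral_finsetSum _ fun _ _ => .of_finite).symm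

theorem IPM_law_elim_le (P : ProbabilityMeasure (R ⊕ ι)) {y y₀ : R → V} {z z' : ι → V} {q : ℕ}
    {H : Set (Distinguisher q V)} {η : ℝ} (hη : 0 ≤ η)
    (h : ∀ S : Finset R, S.card < q → IPM H (law P (Sum.elim (S.piecewise y y₀) z))
      (law P (Sum.elim (S.piecewise y y₀) z')) ≤ η) :
    IPM H (law P (Sum.elim y z)) (law P (Sum.elim y z')) ≤ 4 ^ Fintype.card R * η := by
  refine IPM_le (by positivity) fun g hg => ?_
  rw [← sum_card_lt_moebius_freq P y y₀ z z' g]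
  calc _ ≤ ∑ I : Finset R with I.card < q, 2 ^ Fintype.card R * η := by
        refine (Finset.abs_sum_le_sum_abs _ _).trans (Finset.sum_le_sum fun I hI => ?_)
        refine (abs_moebius_le fun S hS => ?_).trans
          (mul_le_mul_of_nonneg_right (pow_le_pow_right₀ one_le_two I.card_le_univ) hη)
        exact (abs_freq_sub_freq_le_IPM _ _ hg).trans
          (h S ((Finset.card_le_card hS).trans_lt (Finset.mem_filter.1 hI).2))
    _ ≤ ∑ _ : Finset R, 2 ^ Fintype.card R * η :=
        Finset.sum_le_univ_sum_of_nonneg fun _ => by positivity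
    _ = 4 ^ Fintype.card R * η := by
        rw [Finset.sum_const, Finset.card_univ, Fintype.card_finset, nsmul_eq_mul, ← mul_assoc]
        push_cast
        rw [← mul_pow]
        norm_num

end Masking

section ShareClaimLaw

variable {Ω R ι : Type*}

theorem measureReal_pi_existsUnique_mem [MeasurableSpace Ω] (P : ProbabilityMeasure Ω) {A : Set Ω}
    (hA : MeasurableSet A) (k : ℕ) :
    (Measure.pi fun _ : Fin k => (P : Measure Ω)).real {t | ∃! i, t i ∈ A} =
      k * ((P : Measure Ω).real A * (1 - (P : Measure Ω).real A) ^ (k - 1)) := by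
  let box (i j : Fin k) : Set Ω := if j = i then A else Aᶜ
  have hmem : ∀ i t, t ∈ Set.univ.pi (box i) ↔ t i ∈ A ∧ ∀ j, t j ∈ A → j = i := fun i t => by
    simp only [box, Set.mem_univ_pi]
    grind
  have hunion : {t | ∃! i, t i ∈ A} = ⋃ i, Set.univ.pi (box i) := by
    ext t
    simp only [Set.mem_iUnion, hmem]
    rfl
  have hdisj : Pairwise (Function.onFun Disjoint fun i => Set.univ.pi (box i)) := fun i j hij =>
    Set.disjoint_left.2 fun t hi hj => hij (((hmem j t).1 hj).2 i ((hmem i t).1 hi).1)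
  have hbox : ∀ i j, MeasurableSet (box i j) := fun i j => by
    by_cases hji : j = i
    · simpa only [box, if_pos hji] using hA
    · simpa only [box, if_neg hji] using hA.compl
  have hmeas : ∀ i, (Measure.pi fun _ : Fin k => (P : Measure Ω)).real (Set.univ.pi (box i)) =
      (P : Measure Ω).real A * (1 - (P : Measure Ω).real A) ^ (k - 1) := fun i => by
    have hreal : ∀ j, ((P : Measure Ω) (box i j)).toReal =
        if j = i then (P : Measure Ω).real A else 1 - (P : Measure Ω).real A := fun j => by
      rw [← probReal_compl_eq_one_sub hA]
      exact apply_ite (P : Measure Ω).real _ _ _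
    rw [Measure.real, Measure.pi_pi, ENNReal.toReal_prod]
    simp [hreal, Finset.prod_ite, Finset.filter_eq', Finset.filter_ne']
  rw [hunion, measureReal_iUnion_fintype hdisj fun i => .univ_pi (hbox i)]
  simp [hmeas]

theorem exists_probabilityMeasure_sum [Finite R] [Nonempty R] [Finite ι] [Nonempty ι]
    [MeasurableSpace (R ⊕ ι)] [DiscreteMeasurableSpace (R ⊕ ι)] {θ : ℝ} (h₀ : 0 ≤ θ) (h₁ : θ ≤ 1) :
    ∃ P : ProbabilityMeasure (R ⊕ ι),
      (∀ u, (P : Measure (R ⊕ ι)).real {Sum.inl u} = (1 - θ) / Nat.card R) ∧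
      (∀ i, (P : Measure (R ⊕ ι)).real {Sum.inr i} = θ / Nat.card ι) ∧
      (P : Measure (R ⊕ ι)).real (Set.range Sum.inr) = θ := by
  have := Fintype.ofFinite R
  have := Fintype.ofFinite ι
  let w : R ⊕ ι → ℝ := Sum.elim (fun _ => (1 - θ) / Nat.card R) fun _ => θ / Nat.card ι
  have hw : ∀ ω, 0 ≤ w ω := by
    rintro (_ | _)
    · exact div_nonneg (sub_nonneg.2 h₁) (Nat.cast_nonneg _)
    · exact div_nonneg h₀ (Nat.cast_nonneg _)
  have hsum : ∑ ω, ENNReal.ofReal (w ω) = 1 := by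
    rw [← ENNReal.ofReal_sum_of_nonneg fun ω _ => hw ω]
    simp [w, mul_div_cancel₀]
  let p : PMF (R ⊕ ι) := PMF.ofFintype (fun ω => ENNReal.ofReal (w ω)) hsum
  have hp : ∀ ω, p.toMeasure.real {ω} = w ω := fun ω => by
    rw [Measure.real, PMF.toMeasure_apply_singleton _ _ .of_discrete, PMF.ofFintype_apply,
      ENNReal.toReal_ofReal (hw ω)]
  refine ⟨⟨p.toMeasure, inferInstance⟩, fun _ => hp _, fun _ => hp _, ?_⟩
  have hrange : (Set.range Sum.inr : Set (R ⊕ ι)) = ↑(Finset.univ.map .inr : Finset (R ⊕ ι)) := by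
    simp
  rw [ProbabilityMeasure.coe_mk, hrange, ← sum_measureReal_singleton, Finset.sum_map]
  simp [hp, w, mul_div_cancel₀]

theorem exp_neg_one_le_div_succ_pow (q : ℕ) : Real.exp (-1) ≤ ((q : ℝ) / (q + 1)) ^ q := by
  rcases q.eq_zero_or_pos with rfl | hq
  · simp
  have : (0 : ℝ) < q := by exact_mod_cast hq
  have hinv : ((q : ℝ) / (q + 1)) = (1 + (q : ℝ)⁻¹)⁻¹ := by field_simp
  rw [hinv, inv_pow, Real.exp_neg]
  exact inv_anti₀ (by positivity) Real.one_add_inv_pow_le_exp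

end ShareClaimLaw

section ShareHypergraph

open Polynomial

/-- The vertices of the share hypergraph over a finite field `F`: `claim v b` claims that the
secret number `v` is `b`, and `share u y` holds the values at `u` of the first `y.length` secret
polynomials. -/
inductive ShareVertex (F : Type*) [Monoid F] where
  | claim (v : ℕ) (b : F)
  | share (u : Fˣ) (y : List F)

instance {F : Type*} [Monoid F] [Countable F] : Countable (ShareVertex F) := by
  have : Countable Fˣ := Units.val_injective.countable
  let f : ShareVertex F → (ℕ × F) ⊕ (Fˣ × List F)
    | .claim v b => .inl (v, b)
    | .share u y => .inr (u, y)
  refine Function.Injective.countable (f := f) ?_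
  rintro (⟨v, b⟩ | ⟨u, y⟩) (⟨v', b'⟩ | ⟨u', y'⟩) h <;> simp_all [f]

variable {F : Type*} [Field F]

/-- A tuple of distinct vertices is a share edge if it consists of one claim, about the secret
number `v`, and of shares, and a polynomial of degree less than `q` interpolates the value claimed
at `0` and the values number `v` of the shares. -/
def IsShareEdge {κ : Type*} (q : ℕ) (t : κ → ShareVertex F) : Prop :=
  Function.Injective t ∧ ∃ i₀ v, ∃ Q : F[X], Q.degree < q ∧ t i₀ = .claim v (Q.eval 0) ∧
    ∀ i ≠ i₀, ∃ u y, t i = .share u y ∧ y[v]? = some (Q.eval (u : F))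

theorem IsShareEdge.comp_equiv {κ κ' : Type*} {q : ℕ} {t : κ → ShareVertex F}
    (h : IsShareEdge q t) (π : κ' ≃ κ) : IsShareEdge q (t ∘ π) := by
  obtain ⟨ht, i₀, v, Q, hQ, h₀, hshares⟩ := h
  exact ⟨ht.comp π.injective, π.symm i₀, v, Q, hQ, by simpa using h₀, fun i hi =>
    hshares (π i) fun h => hi (π.eq_symm_apply.2 h)⟩

/-- The share hypergraph, transported to the vertex set `V` along `e`. -/
def shareHypergraph {V : Type*} (q : ℕ) (e : ShareVertex F → V) : Distinguisher (q + 1) V where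
  edges := (e ∘ ·) '' {t | IsShareEdge q t}
  symm π v := by
    constructor
    · rintro ⟨t, ht, htv⟩
      refine ⟨t ∘ π.symm, ht.comp_equiv π.symm, ?_⟩
      simpa [Function.comp_assoc] using congrArg (· ∘ π.symm) htv
    · rintro ⟨t, ht, rfl⟩
      exact ⟨t ∘ π, ht.comp_equiv π, rfl⟩

theorem comp_mem_edges_shareHypergraph_iff {V : Type*} {q : ℕ} {e : ShareVertex F → V}
    (he : Function.Injective e) {t : Fin (q + 1) → ShareVertex F} :
    e ∘ t ∈ (shareHypergraph q e).edges ↔ IsShareEdge q t :=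
  he.comp_left.mem_set_image

/-- The placement of the share atoms `u : Fˣ` and the claim atoms `v : Fin n` at the vertices
carrying the share values `y u` and the claimed secrets `X v`. -/
def sharePlacement {n : ℕ} (y : Fˣ → Fin n → F) (X : Fin n → F) : Fˣ ⊕ Fin n → ShareVertex F :=
  placement (fun u => .share u (List.ofFn (y u))) (fun v b => .claim v b) X

theorem sharePlacement_injective {n : ℕ} (y : Fˣ → Fin n → F) (X : Fin n → F) :
    Function.Injective (sharePlacement y X) := by
  rintro (u | v) (u' | v') h
  · simp only [sharePlacement, placement, Sum.elim_inl, ShareVertex.share.injEq] at h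
    rw [h.1]
  · simp [sharePlacement, placement] at h
  · simp [sharePlacement, placement] at h
  · simp only [sharePlacement, placement, Sum.elim_inr, ShareVertex.claim.injEq, Fin.val_inj] at h
    rw [h.1]

variable {n q : ℕ} {f : Fin n → F[X]}

theorem isShareEdge_sharePlacement (hf : ∀ v, (f v).degree < q) {κ : Type*} {t : κ → Fˣ ⊕ Fin n}
    (ht : Function.Injective t) (hclaim : ∃! i, t i ∈ Set.range Sum.inr) :
    IsShareEdge q (sharePlacement (fun u v => (f v).eval (u : F)) (fun v => (f v).eval 0) ∘ t) := by
  obtain ⟨i₀, ⟨v, hv⟩, huniq⟩ := hclaim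
  refine ⟨(sharePlacement_injective _ _).comp ht, i₀, v, f v, hf v, ?_, fun i hi => ?_⟩
  · simp [← hv, sharePlacement, placement]
  · rcases hu : t i with u | v'
    · exact ⟨u, _, by simp only [Function.comp_apply, hu]; rfl, by simp⟩
    · exact (hi (huniq i ⟨v', hu.symm⟩)).elim

theorem not_isShareEdge_sharePlacement (hf : ∀ v, (f v).degree < q) {X : Fin n → F}
    (hX : ∀ v, X v ≠ (f v).eval 0) (t : Fin (q + 1) → Fˣ ⊕ Fin n) :
    ¬IsShareEdge q (sharePlacement (fun u v => (f v).eval (u : F)) X ∘ t) := by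
  rintro ⟨ht, i₀, w, Q, hQ, h₀, hshares⟩
  obtain ⟨v, hv, hXv⟩ : ∃ v : Fin n, (v : ℕ) = w ∧ X v = Q.eval 0 := by
    rcases hi₀ : t i₀ with u | v
    · simp [hi₀, sharePlacement, placement] at h₀
    · exact ⟨v, by simpa [hi₀, sharePlacement, placement] using h₀⟩
  have hshare : ∀ i ≠ i₀, ∃ u : Fˣ, t i = Sum.inl u ∧ (f v).eval (u : F) = Q.eval (u : F) := by
    intro i hi
    obtain ⟨u, y, hu, hy⟩ := hshares i hi
    rcases hti : t i with u' | v'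
    · simp only [Function.comp_apply, hti, sharePlacement, placement, Sum.elim_inl,
        ShareVertex.share.injEq] at hu
      obtain ⟨rfl, rfl⟩ := hu
      exact ⟨u', rfl, by simpa [← hv] using hy⟩
    · simp [hti, sharePlacement, placement] at hu
  choose! u hu heval using hshare
  have hinj : Set.InjOn (fun i => (u i : F)) (Finset.univ.erase i₀ : Finset (Fin (q + 1))) := by
    intro i hi j hj hij
    refine ht.of_comp ?_
    rw [hu i (by simpa using hi), hu j (by simpa using hj), Units.val_injective hij]
  have hcard : (Finset.univ.erase i₀).card = q := by simp
  refine hX v (hXv.trans (congrArg (eval 0) ?_))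
  exact (Polynomial.eq_of_degrees_lt_of_eval_index_eq _ hinj (by rw [hcard]; exact hf v)
    (by rwa [hcard]) fun i hi => heval i (Finset.ne_of_mem_erase hi)).symm

end ShareHypergraph

section FrequencyGap

open Polynomial

variable {F : Type*} [Field F] [Finite F] {n q : ℕ} {f : Fin n → F[X]} {V : Type*}
  [MeasurableSpace (Fˣ ⊕ Fin n)] [DiscreteMeasurableSpace (Fˣ ⊕ Fin n)] [MeasurableSpace V]
  [MeasurableSingletonClass V] {e : ShareVertex F → V}

theorem freq_shareHypergraph_eq_zero (P : ProbabilityMeasure (Fˣ ⊕ Fin n))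
    (he : Function.Injective e) (hf : ∀ v, (f v).degree < q) {X : Fin n → F}
    (hX : ∀ v, X v ≠ (f v).eval 0) :
    freq (law P (e ∘ sharePlacement (fun u v => (f v).eval (u : F)) X)) (shareHypergraph q e) =
      0 := by
  simp only [freq_law, Function.comp_assoc, comp_mem_edges_shareHypergraph_iff he,
    not_isShareEdge_sharePlacement hf hX]
  simp

theorem sub_le_freq_shareHypergraph (P : ProbabilityMeasure (Fˣ ⊕ Fin n))
    (he : Function.Injective e) (hf : ∀ v, (f v).degree < q) {β : ℝ} (hβ₀ : 0 ≤ β)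
    (hβ : ∀ u, (P : Measure (Fˣ ⊕ Fin n)).real {Sum.inl u} ≤ β) :
    (Measure.pi fun _ : Fin (q + 1) => (P : Measure (Fˣ ⊕ Fin n))).real
        {t | ∃! i, t i ∈ Set.range Sum.inr} - (q + 1) ^ 2 * β ≤
      freq (law P (e ∘ sharePlacement (fun u v => (f v).eval (u : F)) fun v => (f v).eval 0))
        (shareHypergraph q e) := by
  simp only [freq_law, Function.comp_assoc, comp_mem_edges_shareHypergraph_iff he]
  have hsub : {t : Fin (q + 1) → Fˣ ⊕ Fin n | ∃! i, t i ∈ Set.range Sum.inr} ⊆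
      {t | IsShareEdge q
        (sharePlacement (fun u v => (f v).eval (u : F)) (fun v => (f v).eval 0) ∘ t)} ∪
      {t | ∃ i j, i ≠ j ∧ t i = t j ∧ t i ∈ Set.range Sum.inl} := by
    intro t ht
    by_cases hinj : Function.Injective t
    · exact .inl (isShareEdge_sharePlacement hf hinj ht)
    obtain ⟨i, j, hij, hne⟩ := Function.not_injective_iff.1 hinj
    refine .inr ⟨i, j, hne, hij, ?_⟩
    rcases hi : t i with u | v
    · exact ⟨u, rfl⟩
    · exact (hne (ht.unique ⟨v, hi.symm⟩ ⟨v, hi.symm.trans hij⟩)).elim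
  have hcollision := measureReal_pi_exists_eq_mem_le P (q + 1) hβ₀ (Set.forall_mem_range.2 hβ)
  push_cast at hcollision
  linarith [(measureReal_mono hsub).trans (measureReal_union_le (μ := Measure.pi
    fun _ : Fin (q + 1) => (P : Measure (Fˣ ⊕ Fin n))) _ _)]

theorem exp_neg_one_le_measureReal_pi_existsUnique_mem {Ω : Type*} [MeasurableSpace Ω]
    (P : ProbabilityMeasure Ω) {A : Set Ω} (hA : MeasurableSet A)
    (hPA : (P : Measure Ω).real A = 1 / (q + 1)) :
    Real.exp (-1) ≤
      (Measure.pi fun _ : Fin (q + 1) => (P : Measure Ω)).real {t | ∃! i, t i ∈ A} := by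
  refine (exp_neg_one_le_div_succ_pow q).trans_eq ?_
  have hcompl : (q : ℝ) / (q + 1) = 1 - 1 / (q + 1) := by field_simp; ring
  rw [measureReal_pi_existsUnique_mem P hA, hPA, hcompl, Nat.add_sub_cancel]
  push_cast
  field_simp

theorem one_quarter_lt_IPM_shareHypergraph {P : ProbabilityMeasure (Fˣ ⊕ Fin n)}
    (hF : 10 * (q + 1) ^ 2 ≤ Nat.card Fˣ)
    (hshare : ∀ u, (P : Measure (Fˣ ⊕ Fin n)).real {Sum.inl u} = (1 - 1 / (q + 1)) / Nat.card Fˣ)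
    (hclaim : (P : Measure (Fˣ ⊕ Fin n)).real (Set.range Sum.inr) = 1 / (q + 1))
    (he : Function.Injective e) (hf : ∀ v, (f v).degree < q) {X : Fin n → F}
    (hX : ∀ v, X v ≠ (f v).eval 0) :
    1 / 4 < IPM {shareHypergraph q e}
      (law P (e ∘ sharePlacement (fun u v => (f v).eval (u : F)) fun v => (f v).eval 0))
      (law P (e ∘ sharePlacement (fun u v => (f v).eval (u : F)) X)) := by
  rw [IPM_singleton, freq_shareHypergraph_eq_zero P he hf hX, sub_zero]
  refine lt_of_lt_of_le ?_ (le_abs_self _)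
  have hF' : 10 * ((q : ℝ) + 1) ^ 2 ≤ Nat.card Fˣ := by exact_mod_cast hF
  have hβ : ∀ u, (P : Measure (Fˣ ⊕ Fin n)).real {Sum.inl u} ≤ 1 / (10 * ((q : ℝ) + 1) ^ 2) :=
    fun u => by
      rw [hshare u]
      gcongr
      exact sub_le_self _ (by positivity)
  calc (1 : ℝ) / 4 < Real.exp (-1) - 1 / 10 := by linarith [Real.exp_neg_one_gt_d9]
    _ = Real.exp (-1) - (q + 1) ^ 2 * (1 / (10 * (q + 1) ^ 2)) := by field_simp
    _ ≤ _ := sub_le_sub_right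
        (exp_neg_one_le_measureReal_pi_existsUnique_mem P .of_discrete hclaim) _
    _ ≤ _ := sub_le_freq_shareHypergraph P he hf (by positivity) hβ

end FrequencyGap

section SecretSharing

open Polynomial

variable {F : Type*} [Field F]

theorem exists_degree_lt_eval_eq_one {S : Finset F} {x : F} (hx : x ∉ S) {q : ℕ}
    (hS : S.card < q) :
    ∃ Q : F[X], Q.degree < q ∧ Q.eval x = 1 ∧ ∀ u ∈ S, Q.eval u = 0 := by
  classical
  have hinj : Set.InjOn (id : F → F) (insert x S : Finset F) := Set.injOn_id _
  refine ⟨Lagrange.basis (insert x S) id x, ?_,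
    Lagrange.eval_basis_self hinj (Finset.mem_insert_self x S), fun u hu => ?_⟩
  · rw [Lagrange.degree_basis hinj (Finset.mem_insert_self x S), Finset.card_insert_of_notMem hx]
    exact_mod_cast hS
  · exact Lagrange.eval_basis_of_ne (v := id) (by rintro rfl; exact hx hu)
      (Finset.mem_insert_of_mem hu)

variable [Finite F] {ι : Type*} [Finite ι]

instance (q : ℕ) : Finite (degreeLT F q) :=
  .of_equiv _ (degreeLTEquiv F q).symm.toEquiv

theorem ncard_secretSharing_le {q : ℕ} {S : Finset Fˣ} (hS : S.card < q)
    {p : (Fˣ → ι → F) → (ι → F) → Prop} (hp : ∀ X, DependsOn (p · X) S) {c : ℝ}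
    (hc : ∀ y, ({X | p y X}.ncard : ℝ) ≤ c * Nat.card (ι → F)) :
    ({f : ι → degreeLT F q | p (fun u v => (f v).1.eval (u : F))
      fun v => (f v).1.eval 0}.ncard : ℝ) ≤ c * Nat.card (ι → degreeLT F q) := by
  classical
  obtain ⟨Q, hQ, hQ₀, hQS⟩ := exists_degree_lt_eval_eq_one (x := (0 : F))
    (S := S.image (Units.val : Fˣ → F)) (by simp) (Finset.card_image_le.trans_lt hS)
  let Q' : degreeLT F q := ⟨Q, mem_degreeLT.2 hQ⟩
  refine ncard_le_of_translates (fun (b : ι → F) v => b v • Q') _ fun f => ?_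
  let y (u : Fˣ) (v : ι) : F := (f v).1.eval (u : F)
  let X₀ (v : ι) : F := (f v).1.eval 0
  have htranslate : ∀ b : ι → F, (p (fun u v => (f v + b v • Q').1.eval (u : F))
      fun v => (f v + b v • Q').1.eval 0) ↔ p y (X₀ + b) := fun b => by
    have hsecret : (fun v => (f v + b v • Q').1.eval 0) = X₀ + b := by
      ext v
      simp [Q', X₀, hQ₀]
    rw [hsecret]
    refine iff_of_eq (hp _ fun u hu => funext fun v => ?_)
    simp [Q', y, hQS u (Finset.mem_image_of_mem _ hu)]
  calc ({b : ι → F | p (fun u v => (f v + b v • Q').1.eval (u : F))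
        fun v => (f v + b v • Q').1.eval 0}.ncard : ℝ)
      = ((X₀ + ·) ⁻¹' {X | p y X}).ncard := by simp only [htranslate]; rfl
    _ = {X | p y X}.ncard := by
        rw [Set.ncard_preimage_of_injective_subset_range (add_right_injective X₀)]
        simp [(add_left_surjective X₀).range_eq]
    _ ≤ c * Nat.card (ι → F) := hc y

end SecretSharing

section Separation

open Polynomial

variable {F : Type*} [Field F] [Finite F] {V : Type*} [MeasurableSpace V]
  [MeasurableSingletonClass V] {q : ℕ}

theorem IsDiscriminating.exists_polynomials_IPM_placement_le {ι : Type*} [Finite ι]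
    [MeasurableSpace (Fˣ ⊕ ι)] [DiscreteMeasurableSpace (Fˣ ⊕ ι)]
    {H : Set (Distinguisher q V)} {A : Algorithm H} {m : ℝ → ℝ → ℕ} (hA : IsDiscriminating H A m)
    {P : ProbabilityMeasure (Fˣ ⊕ ι)} {η β : ℝ} (hη : 0 < η) (hβ₀ : 0 ≤ β)
    (hβ : ∀ i, (P : Measure (Fˣ ⊕ ι)).real {Sum.inr i} ≤ β)
    (hsmall : Nat.card (Finset Fˣ) * (8 * (Nat.card F : ℝ) ^ (2 * (m (η / 2) (1 / 2) + 1)) *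
      q ^ 2 * β / η ^ 2) < 1)
    (τ : Equiv.Perm F) (s : Fˣ → (ι → F) → V) (l : ι → F → V) :
    ∃ f : ι → F[X], (∀ v, (f v).degree < q) ∧
      IPM H
        (law P (placement (fun u => s u fun v => (f v).eval (u : F)) l fun v => (f v).eval 0))
        (law P (placement (fun u => s u fun v => (f v).eval (u : F)) l
          (τ ∘ fun v => (f v).eval 0))) ≤ 4 ^ Nat.card Fˣ * η := by
  classical
  have := Fintype.ofFinite Fˣ
  let masked (S : Finset Fˣ) (y : Fˣ → ι → F) : Fˣ → V :=
    S.piecewise (fun u => s u (y u)) fun u => s u 0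
  let bad (S : Finset Fˣ) (y : Fˣ → ι → F) (X : ι → F) : Prop :=
    η ≤ IPM H (law P (placement (masked S y) l X)) (law P (placement (masked S y) l (τ ∘ X)))
  have hbad : ∀ S : Finset Fˣ, S.card < q →
      ({f : ι → degreeLT F q | bad S (fun u v => (f v).1.eval (u : F))
        fun v => (f v).1.eval 0}.ncard : ℝ) ≤ _ * Nat.card (ι → degreeLT F q) := fun S hS =>
    ncard_secretSharing_le hS (fun X y y' hy => by
      have hmasked : masked S y = masked S y' :=
        S.piecewise_congr (fun u hu => by rw [hy u hu]) fun _ _ => rfl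
      simp only [bad, hmasked]) fun y => hA.ncard_le_IPM_placement_le hη hβ₀ hβ τ (masked S y) l
  obtain ⟨f, hf⟩ := exists_forall_notMem_of_ncard_le (α := ι → degreeLT F q) hsmall
    (T := fun S => {f | S.card < q ∧ bad S (fun u v => (f v).1.eval (u : F))
      fun v => (f v).1.eval 0}) fun S => by
      by_cases hS : S.card < q
      · simpa only [hS, true_and] using hbad S hS
      · simp only [hS, false_and, Set.ofPred_false, Set.ncard_empty, Nat.cast_zero]
        positivity
  refine ⟨fun v => (f v).1, fun v => mem_degreeLT.1 (f v).2, ?_⟩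
  rw [Nat.card_eq_fintype_card]
  exact IPM_law_elim_le P hη.le fun S hS => le_of_not_ge fun h => hf S ⟨hS, h⟩

theorem Discriminable.exists_polynomials_IPM_placement_lt {H : Set (Distinguisher q V)}
    (hH : Discriminable H) {ε : ℝ} (hε : 0 < ε) :
    ∃ β > 0, ∀ (ι : Type) [Finite ι] [MeasurableSpace (Fˣ ⊕ ι)] [DiscreteMeasurableSpace (Fˣ ⊕ ι)]
      (P : ProbabilityMeasure (Fˣ ⊕ ι)), (∀ i, (P : Measure (Fˣ ⊕ ι)).real {Sum.inr i} ≤ β) →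
      ∀ (τ : Equiv.Perm F) (s : Fˣ → (ι → F) → V) (l : ι → F → V),
        ∃ f : ι → F[X], (∀ v, (f v).degree < q) ∧
          IPM H
            (law P (placement (fun u => s u fun v => (f v).eval (u : F)) l fun v => (f v).eval 0))
            (law P (placement (fun u => s u fun v => (f v).eval (u : F)) l
              (τ ∘ fun v => (f v).eval 0))) < ε := by
  obtain ⟨m, A, hA⟩ := hH
  let η := ε / (2 * 4 ^ Nat.card Fˣ)
  have hη : 0 < η := by positivity
  let K : ℝ := Nat.card (Finset Fˣ) * (8 * (Nat.card F : ℝ) ^ (2 * (m (η / 2) (1 / 2) + 1)) *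
    q ^ 2 / η ^ 2)
  have : 0 ≤ K := by positivity
  refine ⟨1 / (K + 1), by positivity, fun ι _ _ _ P hβ τ s l => ?_⟩
  have hsmall : K * (1 / (K + 1)) < 1 := by
    rw [mul_one_div]
    exact (div_lt_one (by positivity)).2 (lt_add_one K)
  obtain ⟨f, hf, hIPM⟩ := hA.exists_polynomials_IPM_placement_le hη (by positivity) hβ
    (lt_of_eq_of_lt (by simp only [K]; ring) hsmall) τ s l
  refine ⟨f, hf, hIPM.trans_lt ?_⟩
  calc 4 ^ Nat.card Fˣ * η = ε / 2 := by simp only [η]; field_simp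
    _ < ε := half_lt_self hε

theorem exists_IPM_lt_and_one_quarter_lt_IPM_shareHypergraph (hF : 10 * (q + 1) ^ 2 ≤ Nat.card Fˣ)
    {e : ShareVertex F → V} (he : Function.Injective e) {H : Set (Distinguisher q V)}
    (hH : Discriminable H) {ε : ℝ} (hε : 0 < ε) :
    ∃ p₁ p₂ : ProbabilityMeasure V, IPM H p₁ p₂ < ε ∧ 1 / 4 < IPM {shareHypergraph q e} p₁ p₂ := by
  obtain ⟨β, hβ₀, hβ⟩ := hH.exists_polynomials_IPM_placement_lt (F := F) hε
  obtain ⟨n, hn⟩ := exists_nat_one_div_lt hβ₀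
  let _ : MeasurableSpace (Fˣ ⊕ Fin (n + 1)) := ⊤
  have hθ : 1 / ((q : ℝ) + 1) ≤ 1 := (div_le_one (by positivity)).2 (by simp)
  obtain ⟨P, hshare, hclaim, hclaims⟩ := exists_probabilityMeasure_sum (R := Fˣ)
    (ι := Fin (n + 1)) (by positivity) hθ
  have hclaim_le : ∀ v, (P : Measure (Fˣ ⊕ Fin (n + 1))).real {Sum.inr v} ≤ β := fun v => by
    rw [hclaim, Nat.card_fin, Nat.cast_succ]
    exact (div_le_div_of_nonneg_right hθ (by positivity)).trans hn.le
  obtain ⟨f, hf, hIPM⟩ := hβ _ P hclaim_le (Equiv.addRight 1)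
    (fun u y => e (.share u (List.ofFn y))) fun v b => e (.claim v b)
  have hplacement : ∀ X : Fin (n + 1) → F,
      placement (fun u : Fˣ => e (.share u (List.ofFn fun v => (f v).eval (u : F))))
        (fun (v : Fin (n + 1)) b => e (.claim v b)) X =
      e ∘ sharePlacement (fun u v => (f v).eval (u : F)) X := fun X => by
    rw [sharePlacement, placement, placement, Sum.comp_elim]
    rfl
  rw [hplacement, hplacement] at hIPM
  exact ⟨_, _, hIPM, one_quarter_lt_IPM_shareHypergraph hF hshare hclaims he hf (by simp)⟩

end Separation

end GraphDiscriminator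

end

theorem mainTheorem4_general (V : Type*) [MeasurableSpace V] [MeasurableSingletonClass V]
    [Infinite V] (q : ℕ) :
    ∃ G : Set (GraphDiscriminator.Distinguisher (q + 1) V),
      GraphDiscriminator.HasSampleComplexity G (fun _ _ => 0) ∧
      ∀ H : Set (GraphDiscriminator.Distinguisher q V), GraphDiscriminator.Discriminable H →
        ∀ ε : ℝ, 0 < ε → ∃ p₁ p₂ : ProbabilityMeasure V,
          GraphDiscriminator.IPM H p₁ p₂ < ε ∧ 1 / 4 < GraphDiscriminator.IPM G p₁ p₂ := by
  obtain ⟨p, hp, hprime⟩ := Nat.exists_infinite_primes (10 * (q + 1) ^ 2 + 1)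
  have := Fact.mk hprime
  have hF : 10 * (q + 1) ^ 2 ≤ Nat.card (ZMod p)ˣ := by
    rw [Nat.card_eq_fintype_card, ZMod.card_units]
    exact Nat.le_sub_one_of_lt hp
  obtain ⟨e, he⟩ := exists_injective_nat (GraphDiscriminator.ShareVertex (ZMod p))
  exact ⟨{GraphDiscriminator.shareHypergraph q (Infinite.natEmbedding V ∘ e)},
    GraphDiscriminator.hasSampleComplexity_singleton _, fun _ hH _ hε =>
    GraphDiscriminator.exists_IPM_lt_and_one_quarter_lt_IPM_shareHypergraph hF
      ((Infinite.natEmbedding V).injective.comp he) hH hε⟩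

theorem mainTheorem4 :
    ∃ C : ℝ, 0 < C ∧ ∀ k : ℕ, 2 ≤ k →
      ∃ G : Set (GraphDiscriminator.Distinguisher k ℕ),
        (∃ m : ℝ → ℝ → ℕ, GraphDiscriminator.HasSampleComplexity G m ∧
          ∀ ε δ : ℝ, 0 < ε → 0 < δ → δ < 1 →
            (m ε δ : ℝ) ≤ C * (((k : ℝ) ^ 2 + Real.log (1 / δ)) / ε ^ 2)) ∧
        ∀ H : Set (GraphDiscriminator.Distinguisher (k - 1) ℕ),
          GraphDiscriminator.Discriminable H →
            ∀ ε : ℝ, 0 < ε →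
              ∃ p₁ p₂ : MeasureTheory.ProbabilityMeasure ℕ,
                GraphDiscriminator.IPM H p₁ p₂ < ε ∧
                  1 / 4 < GraphDiscriminator.IPM G p₁ p₂ := by
  refine ⟨1, one_pos, fun k hk => ?_⟩
  obtain ⟨q, rfl⟩ : ∃ q, k = q + 1 := Nat.exists_eq_add_one.2 (zero_lt_two.trans_le hk)
  obtain ⟨G, hG, hsep⟩ := mainTheorem4_general ℕ q
  refine ⟨G, ⟨fun _ _ => 0, hG, fun ε δ _ hδ hδ₁ => ?_⟩, hsep⟩
  have : 0 ≤ Real.log (1 / δ) := Real.log_nonneg ((one_le_div hδ).2 hδ₁.le)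
  simp only [Nat.cast_zero]
  positivity
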